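/- Let $d,q$ be natural numbers and $\Omega=\{1,\dots,q\}^{\mathbb Z^d}$ with the product topology and Borel $\sigma$-algebra. For finite $\Delta\subset\mathbb Z^d$, a local configuration $\xi_\Delta\in\{1,\dots,q\}^\Delta$ and $\eta\in\Omega$, write $\xi_\Delta\eta_{\Delta^c}$ for the configuration equal to $\xi_\Delta$ on $\Delta$ and to $\eta$ on $\Delta^c$. Let $$Lf(\eta)=\sum_{\Delta\subset\mathbb Z^d\text{ finite}}\ \sum_{\xi_\Delta}c_\Delta(\eta,\xi_\Delta)\,[f(\xi_\Delta\eta_{\Delta^c})-f(\eta)]$$ be the generator of an interacting particle system with rates $c_\Delta(\eta,\xi_\Delta)\ge0$ that are continuous in $\eta$, and put $c_\Delta(\eta)=\sum_{\xi_\Delta}c_\Delta(\eta,\xi_\Delta)$, $c_\Delta=\sup_\eta c_\Delta(\eta)$. Assume: 1. (well-definedness, in the sense of Liggett) $\sup_{x}\sum_{\Delta\ni x}c_\Delta<\infty$ and $\sup_x\sum_{u\ne x}\sum_{\Delta\ni x}c_\Delta(u)<\infty$, where, for a site $u$, $c_\Delta(u)=\sup\{\sum_{\xi_\Delta}|c_\Delta(\eta,\xi_\Delta)-c_\Delta(\eta',\xi_\Delta)|:\eta_y=\eta'_y\text{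 for all }y\ne u\}$; 2. (translation invariance) the rates do not change when $\Delta$, $\eta$ and $\xi_\Delta$ are all translated by the same $i\in\mathbb Z^d$; 3. (finitely many types of transitions) there is a finite set $\Gamma\ni 0$ such that $c_\Delta=0$ whenever $0\in\Delta\not\subset\Gamma$; 4. (uniformly continuous rates) $\lim_{n\to\infty}\sup_{\Delta\ni0}\sup_{\eta,\xi,\sigma_\Delta}|c_\Delta(\eta_{\Lambda_n}\xi_{\Lambda_n^c},\sigma_\Delta)-c_\Delta(\eta,\sigma_\Delta)|=0$, where $\Lambda_n=[-n,n]^d\cap\mathbb Z^d$; 5. (minimal transition rate) for every finite $\Delta$ with $c_\Delta>0$, $\inf\{c_\Delta(\eta,\sigma_\Delta):c_\Delta(\eta,\sigma_\Delta)>0\}>0$; 6. (no trap states) $c_\Delta(\eta,\sigma_\Delta)>0$ implies $c_\Delta(\sigma_\Delta\eta_{\Delta^c})>0$. Call a probability measure $\nu$ on $\Omega$ non-null if there is $\delta>0$ such that, for every $a\in\{1,\dots,q\}$, $\nu(\eta_0=a\mid \eta_x,\,x\ne0)\ge\delta$ for $\nu$-almost every $\eta$. Then for every translation-invariant non-null probability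 measure $\nu$ the specific entropy loss $$g_L(\nu)=\lim_{n\to\infty}\frac1{|\Lambda_n|}\sum_{\omega\in\{1,\dots,q\}^{\Lambda_n}}\nu\big(L1_{\omega}\big)\,\log\nu(\omega)$$ exists as a real number, where $\omega$ is identified with the cylinder set $\{\sigma\in\Omega:\sigma=\omega\text{ on }\Lambda_n\}$ and $1_\omega$ is its indicator function. Moreover $\nu\mapsto g_L(\nu)$ is upper semicontinuous, with respect to the topology of weak convergence, on the set of translation-invariant non-null probability measures on $\Omega$. -/

import Mathlib

open MeasureTheory Filter Topology
open scoped ENNReal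

noncomputable section

namespace EntropyLoss

/-- The lattice `ℤ^d`. -/
abbrev Site (d : ℕ) : Type := Fin d → ℤ

/-- The configuration space: all maps from `ℤ^d` to a set of `q` local states, with the product
topology and the product (equivalently, Borel) sigma-algebra. -/
abbrev Config (d q : ℕ) : Type := Site d → Fin q

/-- Configurations in a finite volume `Δ`. -/
abbrev LocalConfig (d q : ℕ) (Δ : Finset (Site d)) : Type := Δ → Fin q

/-- The configuration `ξ_Δ η_{Δᶜ}`, equal to `ξ` on `Δ` and to `η` off `Δ`. -/
def patch {d q : ℕ} (Δ : Finset (Site d)) (ξ : LocalConfig d q Δ) (η : Config d q) :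
    Config d q :=
  fun x => if h : x ∈ Δ then ξ ⟨x, h⟩ else η x

/-- The lattice translate of a configuration by `i`. -/
def shift {d q : ℕ} (i : Site d) (η : Config d q) : Config d q := fun x => η (x - i)

/-- The lattice translate `Δ + i` of a finite volume. -/
def translate {d : ℕ} (i : Site d) (Δ : Finset (Site d)) : Finset (Site d) :=
  Δ.map (addRightEmbedding i)

/-- The hypercube `[-n, n]^d` centered at the origin. -/
def box (d n : ℕ) : Finset (Site d) := Finset.Icc (fun _ => -(n : ℤ)) (fun _ => (n : ℤ))

/-- The cylinder set of all configurations that agree with `ω` on `Λ`. -/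
def cylinder {d q : ℕ} (Λ : Finset (Site d)) (ω : LocalConfig d q Λ) : Set (Config d q) :=
  {σ | ∀ i : Λ, σ i = ω i}

/-- Jump rates of an interacting particle system: `rate Δ η ξ` is the rate at which the
configuration `η` is replaced by `ξ_Δ η_{Δᶜ}`; it is continuous in `η`. -/
structure IPS (d q : ℕ) where
  rate : (Δ : Finset (Site d)) → Config d q → LocalConfig d q Δ → ℝ
  rate_nonneg : ∀ Δ η ξ, 0 ≤ rate Δ η ξ
  rate_continuous : ∀ Δ ξ, Continuous fun η => rate Δ η ξ

namespace IPS

variable {d q : ℕ} (L : IPS d q)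

/-- The total rate `c_Δ(η) = ∑_ξ c_Δ(η, ξ)`. -/
def totalRate (Δ : Finset (Site d)) (η : Config d q) : ℝ := ∑ ξ, L.rate Δ η ξ

/-- The supremum `c_Δ = sup_η c_Δ(η)`. -/
def supRate (Δ : Finset (Site d)) : ℝ≥0∞ := ⨆ η, ENNReal.ofReal (L.totalRate Δ η)

/-- The influence of the site `u` on the jump measures in `Δ`: the largest total variation
`∑_ξ |c_Δ(η, ξ) - c_Δ(η', ξ)|` over pairs `η, η'` that agree off `u`. -/
def influence (Δ : Finset (Site d)) (u : Site d) : ℝ≥0∞ :=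
  ⨆ (η : Config d q) (η' : Config d q) (_ : ∀ y, y ≠ u → η y = η' y),
    ENNReal.ofReal (∑ ξ, |L.rate Δ η ξ - L.rate Δ η' ξ|)

/-- The generator,
`L f(η) = ∑_Δ ∑_ξ c_Δ(η, ξ) [f(ξ_Δ η_{Δᶜ}) - f(η)]`. -/
def generator (f : Config d q → ℝ) (η : Config d q) : ℝ :=
  ∑' Δ : Finset (Site d), ∑ ξ : LocalConfig d q Δ, L.rate Δ η ξ * (f (patch Δ ξ η) - f η)

/-- Liggett's conditions for the well-definedness of an interacting particle system (together
with the continuity of the rates): the single-site jump intensities are uniformly bounded, and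
so are the total influences of all other sites on the jumps involving a given site. -/
structure WellDefined : Prop where
  bounded_intensity :
    (⨆ x : Site d, ∑' Δ : {Δ : Finset (Site d) // x ∈ Δ}, L.supRate Δ) < ⊤
  bounded_influence :
    (⨆ x : Site d, ∑' u : {u : Site d // u ≠ x},
      ∑' Δ : {Δ : Finset (Site d) // x ∈ Δ}, L.influence Δ u) < ⊤

/-- `c_{Δ+i}(η translated by i, ζ_Δ translated by i) = c_Δ(η, ζ_Δ)`. -/
def TranslationInvariant : Prop :=
  ∀ (i : Site d) (Δ : Finset (Site d)) (η ζ : Config d q),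
    L.rate (translate i Δ) (shift i η) ((translate i Δ).restrict (shift i ζ)) =
      L.rate Δ η (Δ.restrict ζ)

/-- There are only finitely many types of transitions. -/
def FinitelyManyTypes : Prop :=
  ∃ Γ : Finset (Site d), 0 ∈ Γ ∧
    ∀ Δ : Finset (Site d), 0 ∈ Δ → ¬ Δ ⊆ Γ → L.supRate Δ = 0

/-- The rates are uniformly continuous:
`sup_{Δ ∋ 0} sup_{η, ξ, σ} |c_Δ(η_Λ ξ_{Λᶜ}, σ_Δ) - c_Δ(η, σ_Δ)| → 0` along centered
hypercubes `Λ`. -/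
def UniformlyContinuousRates : Prop :=
  Tendsto
    (fun n : ℕ => ⨆ (Δ : Finset (Site d)) (_ : 0 ∈ Δ) (η : Config d q) (ξ : Config d q)
        (σ : LocalConfig d q Δ),
      ENNReal.ofReal
        |L.rate Δ (patch (box d n) ((box d n).restrict η) ξ) σ - L.rate Δ η σ|)
    atTop (𝓝 0)

/-- The system can not enter trap states: `c_Δ(η, σ_Δ) > 0` implies `c_Δ(σ_Δ η_{Δᶜ}) > 0`. -/
def NoTrapStates : Prop :=
  ∀ (Δ : Finset (Site d)) (η : Config d q) (σ : LocalConfig d q Δ),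
    0 < L.rate Δ η σ → 0 < L.totalRate Δ (patch Δ σ η)

/-- The system has a minimal transition rate: if `c_Δ > 0`, then the positive values of
`c_Δ(η, σ_Δ)` are bounded away from zero. -/
def HasMinimalRate : Prop :=
  ∀ Δ : Finset (Site d), 0 < L.supRate Δ →
    ∃ m : ℝ, 0 < m ∧ ∀ (η : Config d q) (σ : LocalConfig d q Δ),
      0 < L.rate Δ η σ → m ≤ L.rate Δ η σ

/-- The normalized finite-volume entropy loss
`|Λ|⁻¹ ∑_{ω_Λ} ν(L 1_{ω_Λ}) log ν(ω_Λ)`. -/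
def entropyLossIn (Λ : Finset (Site d)) (ν : ProbabilityMeasure (Config d q)) : ℝ :=
  (Λ.card : ℝ)⁻¹ * ∑ ω : LocalConfig d q Λ,
    (∫ η, L.generator ((cylinder Λ ω).indicator 1) η ∂(ν : Measure (Config d q))) *
      Real.log ((ν : Measure (Config d q)).real (cylinder Λ ω))

/-- The specific entropy loss `g_L(ν)`: the limit of the normalized finite-volume entropy losses
along centered hypercubes (meaningful when the limit exists). -/
def specificEntropyLoss (ν : ProbabilityMeasure (Config d q)) : ℝ :=
  limUnder atTop fun n : ℕ => L.entropyLossIn (box d n) ν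

end IPS

/-- Translation invariance of a probability measure on configurations. -/
def TranslationInvariantMeasure {d q : ℕ} (ν : ProbabilityMeasure (Config d q)) : Prop :=
  ∀ i : Site d, (ν : Measure (Config d q)).map (shift i) = (ν : Measure (Config d q))

/-- The sigma-algebra generated by the coordinates at all sites other than the origin. -/
abbrev offOrigin (d q : ℕ) : MeasurableSpace (Config d q) :=
  MeasurableSpace.comap (fun (η : Config d q) (x : {x : Site d // x ≠ 0}) => η x)
    MeasurableSpace.pi

/-- Non-nullness: the conditional probabilities of all the local states at the origin, given the
configuration off the origin, are bounded away from zero almost surely. -/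
def NonNull {d q : ℕ} (ν : ProbabilityMeasure (Config d q)) : Prop :=
  ∃ δ : ℝ, 0 < δ ∧ ∀ a : Fin q, ∀ᵐ η ∂(ν : Measure (Config d q)),
    δ ≤ ((ν : Measure (Config d q))[({σ : Config d q | σ 0 = a}).indicator
      (fun _ => (1 : ℝ)) | offOrigin d q]) η

end EntropyLoss

end

/-!
# Existence and upper semicontinuity of the specific entropy loss

Write `P_Λ(η)` for the `ν`-probability of the spins of `η` in the finite volume `Λ` (`cylProb`).
Summing `ν(L 1_ω) log ν(ω)` over `ω` turns the entropy loss in `Λ` into a sum over transitions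
`η ↦ ξ_D η` of the expectations `∫ c_D(η, ξ) R_Λ(η) dν(η)` (`lossTerm`), where
`R_Λ(η) = log P_Λ(ξ_D η) - log P_Λ(η)` (`logRatio`). Non-nullness and translation invariance bound
`R_Λ` uniformly in `Λ` (`NonNull.exists_finiteEnergy`, `FiniteEnergy.abs_logRatio_le`).

The key point is a monotonicity. The integral `∫ h exp(R_Λ) dν` does not depend on `Λ`, as long as
`Λ` contains `D` and determines `h` (`integral_mul_cylProb_ratio`). With `log x ≤ x - 1` it follows
that `∫ g R_Λ dν` decreases in `Λ` for every local function `g ≥ 0` (`FiniteEnergy.lossTerm_anti`);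
this is the log-sum inequality, that is, the convexity of relative entropy. Being bounded, these
integrals converge, and for fixed `Λ` they depend continuously on `ν`, so that the limit is an
infimum of continuous functions. No conditional probabilities in infinite volume are needed.

A continuous rate `c ≥ 0` is approximated uniformly from below by local functions `g ≥ 0`
(`exists_local_le`). The uniform bound on `R_Λ` gives convergence of the loss terms
(`FiniteEnergy.tendsto_lossTerm`). That bound is not uniform in `ν`, but for semicontinuity only an
upper bound on the error `∫ (c - g) R_Λ dν` is required, and `R ≤ exp R` provides one that is
independent of `ν` and `Λ` (`FiniteEnergy.lossTerm_le`, `upperSemicontinuousOn_limitTerm`).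

Finally, distributing the loss of each transition evenly over the sites of `Λ` that it affects
writes the entropy loss in `Λ` as `∑ x ∈ Λ, B (Λ - x)`, with a bounded function `B` of finite volumes
(`IPS.siteLoss`) that converges along all finite volumes. Its averages over boxes converge to the
same limit (`tendsto_average_box`), and this limit is a finite combination, with positive
coefficients, of upper semicontinuous functions of `ν`.
-/

namespace EntropyLoss

variable {d q : ℕ}

/-! ### Configurations, cylinders and local functions -/

theorem patch_of_mem {Δ : Finset (Site d)} (ξ : LocalConfig d q Δ) (η : Config d q) {x : Site d}
    (hx : x ∈ Δ) : patch Δ ξ η x = ξ ⟨x, hx⟩ := dif_pos hx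

theorem patch_of_notMem {Δ : Finset (Site d)} (ξ : LocalConfig d q Δ) (η : Config d q)
    {x : Site d} (hx : x ∉ Δ) : patch Δ ξ η x = η x := dif_neg hx

@[simp]
theorem restrict_patch (Δ : Finset (Site d)) (ξ : LocalConfig d q Δ) (η : Config d q) :
    Δ.restrict (patch Δ ξ η) = ξ := by
  ext1 x
  exact patch_of_mem ξ η x.2

theorem patch_patch (Δ : Finset (Site d)) (ξ ξ' : LocalConfig d q Δ) (η : Config d q) :
    patch Δ ξ (patch Δ ξ' η) = patch Δ ξ η := by
  ext1 x
  by_cases hx : x ∈ Δ <;> simp [patch, hx]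

theorem patch_restrict_self (Δ : Finset (Site d)) (η : Config d q) :
    patch Δ (Δ.restrict η) η = η := by
  ext1 x
  by_cases hx : x ∈ Δ <;> simp [patch, hx]

theorem continuous_patch (Δ : Finset (Site d)) (ξ : LocalConfig d q Δ) :
    Continuous (patch Δ ξ) := by
  refine continuous_pi fun x => ?_
  by_cases hx : x ∈ Δ
  · simp only [patch, hx, dite_true]; exact continuous_const
  · simp only [patch, hx, dite_false]; exact continuous_apply x

theorem mem_cylinder_iff {Λ : Finset (Site d)} {ω : LocalConfig d q Λ} {η : Config d q} :
    η ∈ cylinder Λ ω ↔ Λ.restrict η = ω := by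
  simp [cylinder, funext_iff]

theorem restrict_eq_restrict_iff {Λ : Finset (Site d)} {η η' : Config d q} :
    Λ.restrict η = Λ.restrict η' ↔ ∀ x ∈ Λ, η x = η' x := by
  simp [funext_iff]

theorem continuous_restrict (Λ : Finset (Site d)) :
    Continuous (Λ.restrict : Config d q → LocalConfig d q Λ) :=
  continuous_pi fun x => continuous_apply x.1

theorem isClopen_cylinder (Λ : Finset (Site d)) (ω : LocalConfig d q Λ) :
    IsClopen (cylinder Λ ω) := by
  have : cylinder Λ ω =
      (Λ.restrict : Config d q → LocalConfig d q Λ) ⁻¹' ({ω} : Set (LocalConfig d q Λ)) := by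
    ext η; exact mem_cylinder_iff
  rw [this]
  exact (isClopen_discrete ({ω} : Set (LocalConfig d q Λ))).preimage (continuous_restrict Λ)

theorem measurableSet_cylinder (Λ : Finset (Site d)) (ω : LocalConfig d q Λ) :
    MeasurableSet (cylinder Λ ω) := (isClopen_cylinder Λ ω).isOpen.measurableSet

theorem continuous_indicator_cylinder (Λ : Finset (Site d)) (ω : LocalConfig d q Λ) :
    Continuous ((cylinder Λ ω).indicator (1 : Config d q → ℝ)) :=
  (continuous_one).indicator (by simp [(isClopen_cylinder Λ ω).frontier_eq])

theorem continuous_of_dependsOn {Λ : Finset (Site d)} {h : Config d q → ℝ}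
    (hh : DependsOn h (Λ : Set (Site d))) : Continuous h := by
  rcases isEmpty_or_nonempty (Config d q) with he | ⟨⟨η₀⟩⟩
  · exact continuous_of_discreteTopology
  have : h = (fun ω : LocalConfig d q Λ => h (patch Λ ω η₀)) ∘ Λ.restrict := by
    ext η
    refine hh fun x hx => ?_
    rw [patch_of_mem _ _ (Finset.mem_coe.1 hx)]
    rfl
  rw [this]
  exact continuous_of_discreteTopology.comp (continuous_restrict Λ)

theorem _root_.Continuous.integrable_config {f : Config d q → ℝ} (hf : Continuous f)
    (ν : ProbabilityMeasure (Config d q)) : Integrable f (ν : Measure (Config d q)) :=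
  hf.integrable_of_hasCompactSupport (HasCompactSupport.of_compactSpace f)

/-- The integral of a function of the spins in a finite volume is a finite sum over cylinders;
`η₀` merely serves to extend local configurations. -/
theorem integral_eq_sum_of_dependsOn (ν : ProbabilityMeasure (Config d q)) (η₀ : Config d q)
    {Λ : Finset (Site d)} {h : Config d q → ℝ} (hh : DependsOn h (Λ : Set (Site d))) :
    ∫ η, h η ∂(ν : Measure (Config d q)) =
      ∑ ω : LocalConfig d q Λ,
        h (patch Λ ω η₀) * (ν : Measure (Config d q)).real (cylinder Λ ω) := by
  have key : ∀ η, h η = ∑ ω : LocalConfig d q Λ,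
      h (patch Λ ω η₀) * (cylinder Λ ω).indicator (1 : Config d q → ℝ) η := by
    intro η
    rw [Finset.sum_eq_single (Λ.restrict η)]
    · rw [Set.indicator_of_mem (mem_cylinder_iff.2 rfl), Pi.one_apply, mul_one]
      refine hh fun x hx => ?_
      rw [patch_of_mem _ _ (Finset.mem_coe.1 hx)]
      rfl
    · intro ω _ hω
      rw [Set.indicator_of_notMem (fun hm => hω (mem_cylinder_iff.1 hm).symm), mul_zero]
    · simp
  rw [integral_congr_ae (Eventually.of_forall key), integral_finsetSum _ fun ω _ =>
    ((continuous_indicator_cylinder Λ ω).integrable_config ν).const_mul _]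
  refine Finset.sum_congr rfl fun ω _ => ?_
  rw [integral_const_mul, integral_indicator_one (measurableSet_cylinder Λ ω)]

/-- A nonnegative continuous function is approximated uniformly from below by nonnegative
functions depending on finitely many spins. -/
theorem exists_local_le {f : Config d q → ℝ} (hf : Continuous f) (hf0 : ∀ η, 0 ≤ f η) {ε : ℝ}
    (hε : 0 < ε) : ∃ (Λ : Finset (Site d)) (g : Config d q → ℝ),
      DependsOn g (Λ : Set (Site d)) ∧ (∀ η, 0 ≤ g η) ∧ (∀ η, g η ≤ f η) ∧
        ∀ η, f η - g η ≤ ε := by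
  rcases isEmpty_or_nonempty (Config d q) with he | ⟨⟨η₀⟩⟩
  · exact ⟨∅, f, fun η => (he.false η).elim, hf0, fun _ => le_rfl, fun η => (he.false η).elim⟩
  -- By compactness, finitely many coordinates determine `f` up to `ε / 2`.
  obtain ⟨Λ, hΛ⟩ : ∃ Λ : Finset (Site d), ∀ η η' : Config d q,
      (∀ x ∈ Λ, η x = η' x) → |f η - f η'| ≤ ε / 2 := by
    have hloc : ∀ η : Config d q, ∃ Λ : Finset (Site d), ∀ η' : Config d q,
        (∀ x ∈ Λ, η' x = η x) → |f η' - f η| < ε / 4 := by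
      intro η
      have hm : {η' | |f η' - f η| < ε / 4} ∈ 𝓝 η := by
        have := hf.continuousAt (x := η) (Metric.ball_mem_nhds (f η) (show 0 < ε / 4 by linarith))
        simpa [Metric.ball, Real.dist_eq, Set.preimage] using this
      rw [nhds_pi, Filter.mem_pi'] at hm
      obtain ⟨Λ, t, ht, hsub⟩ := hm
      exact ⟨Λ, fun η' h => hsub fun x hx => by
        rw [h x hx]; exact mem_of_mem_nhds (ht x)⟩
    choose Λ hΛ using hloc
    obtain ⟨s, hs⟩ := isCompact_univ.elim_nhds_subcover
      (fun η : Config d q => cylinder (Λ η) ((Λ η).restrict η))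
      (fun η _ => (isClopen_cylinder _ _).isOpen.mem_nhds (mem_cylinder_iff.2 rfl))
    refine ⟨s.biUnion Λ, fun η η' h => ?_⟩
    obtain ⟨ζ, hζs, hζ⟩ := Set.mem_iUnion₂.1 (hs.2 (Set.mem_univ η))
    have h1 := restrict_eq_restrict_iff.1 (mem_cylinder_iff.1 hζ)
    have e1 := hΛ ζ η h1
    have e2 := hΛ ζ η' fun x hx => by
      rw [← h1 x hx, h x (Finset.mem_biUnion.2 ⟨ζ, hζs, hx⟩)]
    rw [abs_lt] at e1 e2
    rw [abs_le]
    constructor <;> linarith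
  refine ⟨Λ, fun η => max (f (patch Λ (Λ.restrict η) η₀) - ε / 2) 0, ?_, ?_, ?_, ?_⟩
  · intro η η' h
    have : Λ.restrict η = Λ.restrict η' := restrict_eq_restrict_iff.2 h
    simp only [this]
  · exact fun η => le_max_right _ _
  all_goals
    intro η
    have := hΛ (patch Λ (Λ.restrict η) η₀) η fun x hx => by
      rw [patch_of_mem _ _ hx]; rfl
    rw [abs_le] at this
  · exact max_le (by linarith) (hf0 η)
  · have := le_max_left (f (patch Λ (Λ.restrict η) η₀) - ε / 2) 0
    linarith

/-! ### Cylinder probabilities and their ratios -/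

/-- The probability under `ν` of the spins seen by `η` in the finite volume `Λ`. -/
noncomputable def cylProb (ν : ProbabilityMeasure (Config d q)) (Λ : Finset (Site d))
    (η : Config d q) : ℝ :=
  (ν : Measure (Config d q)).real (cylinder Λ (Λ.restrict η))

theorem dependsOn_cylProb (ν : ProbabilityMeasure (Config d q)) (Λ : Finset (Site d)) :
    DependsOn (cylProb ν Λ) (Λ : Set (Site d)) := by
  intro η η' h
  rw [cylProb, restrict_eq_restrict_iff.2 h, cylProb]

theorem dependsOn_comp_patch {Λ : Finset (Site d)} {h : Config d q → ℝ}
    (hh : DependsOn h (Λ : Set (Site d))) (Δ : Finset (Site d)) (ξ : LocalConfig d q Δ) :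
    DependsOn (fun η => h (patch Δ ξ η)) (Λ : Set (Site d)) := by
  intro η η' hη
  refine hh fun x hx => ?_
  by_cases hx' : x ∈ Δ
  · rw [patch_of_mem _ _ hx', patch_of_mem _ _ hx']
  · rw [patch_of_notMem _ _ hx', patch_of_notMem _ _ hx', hη x hx]

/-- Change of measure: tilting `ν` by the ratio of the cylinder probabilities after and before
setting the spins in `D` to `ξ` amounts to conditioning on `ξ` and counting over all the spins in
`D`. The right-hand side does not involve the volume `Λ`. -/
theorem integral_mul_cylProb_ratio (ν : ProbabilityMeasure (Config d q))
    {D Λ : Finset (Site d)} (hD : D ⊆ Λ) (hpos : ∀ η, 0 < cylProb ν Λ η)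
    (ξ : LocalConfig d q D) {h : Config d q → ℝ} (hh : DependsOn h (Λ : Set (Site d))) :
    ∫ η, h η * (cylProb ν Λ (patch D ξ η) / cylProb ν Λ η) ∂(ν : Measure (Config d q)) =
      ∫ η, (if D.restrict η = ξ then ∑ a, h (patch D a η) else 0)
        ∂(ν : Measure (Config d q)) := by
  obtain ⟨η₀⟩ : Nonempty (Config d q) := ν.nonempty
  have hP := dependsOn_cylProb ν Λ
  rw [integral_eq_sum_of_dependsOn ν η₀ (Λ := Λ), integral_eq_sum_of_dependsOn ν η₀ (Λ := Λ)]
  rotate_left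
  · intro η η' hη
    have : D.restrict η = D.restrict η' := restrict_eq_restrict_iff.2 fun x hx => hη x (hD hx)
    simp only [this]
    congr 1
    exact Finset.sum_congr rfl fun a _ => dependsOn_comp_patch hh D a hη
  · intro η η' hη
    simp only [hh hη, hP hη, dependsOn_comp_patch hP D ξ hη]
  -- A local configuration `ω` in `Λ` is represented by its extension by `η₀`.
  have e1 : ∀ ω : LocalConfig d q Λ, (ν : Measure (Config d q)).real (cylinder Λ ω) =
      cylProb ν Λ (patch Λ ω η₀) := fun ω => by rw [cylProb, restrict_patch]
  have e2 : ∀ η, patch Λ (Λ.restrict η) η₀ = η ↔ ∀ x, x ∉ Λ → η₀ x = η x := by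
    intro η
    constructor
    · intro h x hx
      rw [← h, patch_of_notMem _ _ hx]
    · intro h
      ext1 x
      by_cases hx : x ∈ Λ
      · rw [patch_of_mem _ _ hx]; rfl
      · rw [patch_of_notMem _ _ hx, h x hx]
  have e3 : ∀ (ω : LocalConfig d q Λ) (a : LocalConfig d q D),
      patch Λ (Λ.restrict (patch D a (patch Λ ω η₀))) η₀ = patch D a (patch Λ ω η₀) := by
    intro ω a
    rw [e2]
    intro x hx
    rw [patch_of_notMem _ _ (fun hx' => hx (hD hx')), patch_of_notMem _ _ hx]
  calc _ = ∑ ω : LocalConfig d q Λ, h (patch Λ ω η₀) *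
        cylProb ν Λ (patch D ξ (patch Λ ω η₀)) := by
        refine Finset.sum_congr rfl fun ω _ => ?_
        rw [e1]
        have := (hpos (patch Λ ω η₀)).ne'
        field_simp
    _ = ∑ p ∈ (Finset.univ : Finset (LocalConfig d q Λ × LocalConfig d q D)).filter
          (fun p => D.restrict (patch Λ p.1 η₀) = ξ),
          h (patch D p.2 (patch Λ p.1 η₀)) * cylProb ν Λ (patch Λ p.1 η₀) := by
        -- Keep the spins in `D` that `ξ` overwrites as a second component: this is a bijection
        -- onto the pairs whose first component equals `ξ` on `D`.
        refine Finset.sum_bij'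
          (fun ω _ => (Λ.restrict (patch D ξ (patch Λ ω η₀)), D.restrict (patch Λ ω η₀)))
          (fun p _ => Λ.restrict (patch D p.2 (patch Λ p.1 η₀))) ?_ ?_ ?_ ?_ ?_
        · intro ω _
          simp only [Finset.mem_filter, Finset.mem_univ, true_and]
          rw [e3, restrict_patch]
        · simp
        · intro ω _
          simp only
          rw [e3, patch_patch, patch_restrict_self, restrict_patch]
        · rintro ⟨ω, a⟩ hp
          simp only [Finset.mem_filter, Finset.mem_univ, true_and] at hp
          simp only
          rw [e3, patch_patch, restrict_patch, ← hp, patch_restrict_self, restrict_patch]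
        · intro ω _
          simp only
          rw [e3, patch_patch, patch_restrict_self]
    _ = _ := by
        rw [Finset.sum_filter, ← Finset.univ_product_univ, Finset.sum_product]
        refine Finset.sum_congr rfl fun ω _ => ?_
        rw [e1]
        by_cases hω : D.restrict (patch Λ ω η₀) = ξ
        · simp only [hω, if_true, Finset.sum_mul]
        · simp only [hω, if_false, Finset.sum_const_zero, zero_mul]

theorem continuous_cylProb (Λ : Finset (Site d)) (η : Config d q) :
    Continuous fun ν : ProbabilityMeasure (Config d q) => cylProb ν Λ η := by
  let f : BoundedContinuousFunction (Config d q) ℝ := BoundedContinuousFunction.mkOfCompact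
    ⟨_, continuous_indicator_cylinder Λ (Λ.restrict η)⟩
  have := ProbabilityMeasure.continuous_integral_boundedContinuousFunction f
  refine this.congr fun ν => ?_
  exact integral_indicator_one (measurableSet_cylinder _ _)

/-- The finite-volume form of non-nullness: changing a single spin changes the probability of
a cylinder at most by the factor `δ`, uniformly in the volume. -/
structure FiniteEnergy (ν : ProbabilityMeasure (Config d q)) (δ : ℝ) : Prop where
  pos : 0 < δ
  le_one : δ ≤ 1
  mul_le : ∀ (x : Site d) (Λ : Finset (Site d)) (η η' : Config d q), (∀ y, y ≠ x → η y = η' y) →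
    δ * cylProb ν Λ η ≤ cylProb ν Λ η'

namespace FiniteEnergy

variable {ν : ProbabilityMeasure (Config d q)} {δ : ℝ}

theorem pow_mul_le (hν : FiniteEnergy ν δ) (D Λ : Finset (Site d)) (η η' : Config d q)
    (h : ∀ y, y ∉ D → η y = η' y) : δ ^ D.card * cylProb ν Λ η ≤ cylProb ν Λ η' := by
  induction D using Finset.induction_on generalizing η' with
  | empty =>
    have : η = η' := funext fun y => h y (Finset.notMem_empty y)
    simp [this]
  | insert x D hx ih =>
    rw [Finset.card_insert_of_notMem hx, pow_succ, mul_comm (δ ^ _), mul_assoc]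
    refine (mul_le_mul_of_nonneg_left (ih (Function.update η' x (η x)) ?_) hν.pos.le).trans
      (hν.mul_le x Λ _ _ fun y hy => Function.update_of_ne hy _ _)
    intro y hy
    rcases eq_or_ne y x with rfl | hyx
    · rw [Function.update_self]
    · rw [Function.update_of_ne hyx]
      exact h y (by simp [hyx, hy])

theorem cylProb_pos (hν : FiniteEnergy ν δ) (Λ : Finset (Site d)) (η : Config d q) :
    0 < cylProb ν Λ η := by
  -- Some configuration in `Λ` has positive probability, hence all have.
  obtain ⟨ω, hω⟩ : ∃ ω : LocalConfig d q Λ,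
      0 < (ν : Measure (Config d q)).real (cylinder Λ ω) := by
    by_contra! hcon
    have := integral_eq_sum_of_dependsOn ν η (Λ := Λ) (h := fun _ => 1) (fun _ _ _ => rfl)
    simp only [integral_const, probReal_univ, smul_eq_mul, mul_one, one_mul] at this
    linarith [Finset.sum_nonpos (s := Finset.univ) fun ω _ => hcon ω]
  have h1 := hν.pow_mul_le Λ Λ (patch Λ ω η) η fun y hy => patch_of_notMem _ _ hy
  rw [cylProb, restrict_patch] at h1
  exact (mul_pos (pow_pos hν.pos _) hω).trans_le h1

end FiniteEnergy

/-- The logarithm of the ratio of the cylinder probabilities in `Λ` after and before the spins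
in `D` are set to `ξ`. -/
noncomputable def logRatio (ν : ProbabilityMeasure (Config d q)) (D : Finset (Site d))
    (ξ : LocalConfig d q D) (Λ : Finset (Site d)) (η : Config d q) : ℝ :=
  Real.log (cylProb ν Λ (patch D ξ η)) - Real.log (cylProb ν Λ η)

theorem dependsOn_logRatio (ν : ProbabilityMeasure (Config d q)) (D : Finset (Site d))
    (ξ : LocalConfig d q D) (Λ : Finset (Site d)) :
    DependsOn (logRatio ν D ξ Λ) (Λ : Set (Site d)) := by
  intro η η' h
  simp only [logRatio, dependsOn_cylProb ν Λ h,
    dependsOn_comp_patch (dependsOn_cylProb ν Λ) D ξ h]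

theorem continuous_logRatio (ν : ProbabilityMeasure (Config d q)) (D : Finset (Site d))
    (ξ : LocalConfig d q D) (Λ : Finset (Site d)) : Continuous (logRatio ν D ξ Λ) :=
  continuous_of_dependsOn (dependsOn_logRatio ν D ξ Λ)

/-- The expectation of a rate function `f` times the log ratio: the contribution of the
transition to `ξ` on `D` to the entropy loss in `Λ`. -/
noncomputable def lossTerm (f : Config d q → ℝ) (D : Finset (Site d)) (ξ : LocalConfig d q D)
    (ν : ProbabilityMeasure (Config d q)) (Λ : Finset (Site d)) : ℝ :=
  ∫ η, f η * logRatio ν D ξ Λ η ∂(ν : Measure (Config d q))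

variable {ν : ProbabilityMeasure (Config d q)} {δ : ℝ}

theorem FiniteEnergy.abs_logRatio_le (hν : FiniteEnergy ν δ) (D : Finset (Site d))
    (ξ : LocalConfig d q D) (Λ : Finset (Site d)) (η : Config d q) :
    |logRatio ν D ξ Λ η| ≤ D.card * -Real.log δ := by
  have key : ∀ η η' : Config d q, (∀ y, y ∉ D → η y = η' y) →
      D.card * Real.log δ + Real.log (cylProb ν Λ η) ≤ Real.log (cylProb ν Λ η') := by
    intro η η' h
    rw [← Real.log_pow, ← Real.log_mul (pow_pos hν.pos _).ne' (hν.cylProb_pos Λ η).ne']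
    exact Real.log_le_log (mul_pos (pow_pos hν.pos _) (hν.cylProb_pos Λ η))
      (hν.pow_mul_le D Λ η η' h)
  have h1 := key η (patch D ξ η) fun y hy => (patch_of_notMem _ _ hy).symm
  have h2 := key (patch D ξ η) η fun y hy => patch_of_notMem _ _ hy
  rw [logRatio, abs_le]
  constructor <;> linarith

theorem FiniteEnergy.exp_logRatio (hν : FiniteEnergy ν δ) (D : Finset (Site d))
    (ξ : LocalConfig d q D) (Λ : Finset (Site d)) (η : Config d q) :
    Real.exp (logRatio ν D ξ Λ η) = cylProb ν Λ (patch D ξ η) / cylProb ν Λ η := by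
  rw [logRatio, Real.exp_sub, Real.exp_log (hν.cylProb_pos _ _), Real.exp_log (hν.cylProb_pos _ _)]

/-! ### Convergence and semicontinuity of a single loss term -/

/-- Enlarging the volume decreases the loss term of a nonnegative local rate: this is the
log-sum inequality, in the form `log x ≤ x - 1` under the tilted measure. -/
theorem FiniteEnergy.lossTerm_anti (hν : FiniteEnergy ν δ) {D Λ Λ' : Finset (Site d)}
    (ξ : LocalConfig d q D) {g : Config d q → ℝ} (hg : DependsOn g (Λ : Set (Site d)))
    (hg0 : ∀ η, 0 ≤ g η) (hD : D ⊆ Λ) (hΛ : Λ ⊆ Λ') :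
    lossTerm g D ξ ν Λ' ≤ lossTerm g D ξ ν Λ := by
  set h : Config d q → ℝ := fun η => g η * Real.exp (-logRatio ν D ξ Λ η) with hh
  have hdep : DependsOn h (Λ : Set (Site d)) := fun η η' e => by
    simp only [hh, hg e, dependsOn_logRatio ν D ξ Λ e]
  have hsub : (Λ : Set (Site d)) ⊆ Λ' := Finset.coe_subset.2 hΛ
  have hgc := continuous_of_dependsOn hg
  have hR := continuous_logRatio ν D ξ Λ
  have hR' := continuous_logRatio ν D ξ Λ'
  have hhc := continuous_of_dependsOn hdep
  have i1 : ∫ η, h η * Real.exp (logRatio ν D ξ Λ' η) ∂(ν : Measure (Config d q)) =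
      ∫ η, g η ∂(ν : Measure (Config d q)) := by
    simp_rw [hν.exp_logRatio]
    rw [integral_mul_cylProb_ratio ν (hD.trans hΛ) (hν.cylProb_pos Λ') ξ (hdep.mono hsub),
      ← integral_mul_cylProb_ratio ν hD (hν.cylProb_pos Λ) ξ hdep]
    simp_rw [← hν.exp_logRatio, hh, mul_assoc, ← Real.exp_add]
    simp
  have i2 : lossTerm g D ξ ν Λ' ≤
      ∫ η, (g η * logRatio ν D ξ Λ η + (h η * Real.exp (logRatio ν D ξ Λ' η) - g η))
        ∂(ν : Measure (Config d q)) := by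
    refine integral_mono ((hgc.mul hR').integrable_config ν)
      (((hgc.mul hR).add ((hhc.mul hR'.rexp).sub hgc)).integrable_config ν) fun η => ?_
    have := mul_le_mul_of_nonneg_left
      (Real.add_one_le_exp (logRatio ν D ξ Λ' η - logRatio ν D ξ Λ η)) (hg0 η)
    simp only [hh]
    rw [mul_assoc, ← Real.exp_add, neg_add_eq_sub]
    linarith
  have j1 : Integrable (fun η => g η * logRatio ν D ξ Λ η) (ν : Measure (Config d q)) :=
    (hgc.mul hR).integrable_config ν
  have j2 : Integrable (fun η => h η * Real.exp (logRatio ν D ξ Λ' η))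
      (ν : Measure (Config d q)) := (hhc.mul hR'.rexp).integrable_config ν
  have j3 := hgc.integrable_config ν
  refine i2.trans_eq ((integral_add j1 (j2.sub j3)).trans ?_)
  rw [integral_sub' j2 j3, i1, sub_self, add_zero, lossTerm]

theorem FiniteEnergy.abs_lossTerm_le (hν : FiniteEnergy ν δ) {f : Config d q → ℝ} {C : ℝ}
    (hC : ∀ η, |f η| ≤ C) (D Λ : Finset (Site d)) (ξ : LocalConfig d q D) :
    |lossTerm f D ξ ν Λ| ≤ C * (D.card * -Real.log δ) := by
  have := norm_integral_le_of_norm_le_const (μ := (ν : Measure (Config d q)))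
    (f := fun η => f η * logRatio ν D ξ Λ η) (C := C * (D.card * -Real.log δ))
    (Eventually.of_forall fun η => by
      rw [Real.norm_eq_abs, abs_mul]
      exact mul_le_mul (hC η) (hν.abs_logRatio_le D ξ Λ η) (abs_nonneg _)
        ((abs_nonneg _).trans (hC η)))
  simpa [lossTerm] using this

theorem lossTerm_sub {f g : Config d q → ℝ} (hf : Continuous f) (hg : Continuous g)
    (D Λ : Finset (Site d)) (ξ : LocalConfig d q D) :
    lossTerm (fun η => f η - g η) D ξ ν Λ = lossTerm f D ξ ν Λ - lossTerm g D ξ ν Λ := by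
  have hR := continuous_logRatio ν D ξ Λ
  have j1 : Integrable (fun η => f η * logRatio ν D ξ Λ η) (ν : Measure (Config d q)) :=
    (hf.mul hR).integrable_config ν
  have j2 : Integrable (fun η => g η * logRatio ν D ξ Λ η) (ν : Measure (Config d q)) :=
    (hg.mul hR).integrable_config ν
  simp only [lossTerm, sub_mul]
  exact integral_sub j1 j2

/-- An upper bound for the loss term of a small rate that, unlike
`FiniteEnergy.abs_lossTerm_le`, does not depend on the constant in the non-nullness of `ν`.
The positive part of the log ratio is at most its exponential, whose expectation is bounded. -/
theorem FiniteEnergy.lossTerm_le (hν : FiniteEnergy ν δ) {f : Config d q → ℝ}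
    (hf : Continuous f) {ε : ℝ} (hf0 : ∀ η, 0 ≤ f η) (hε : ∀ η, f η ≤ ε)
    {D Λ : Finset (Site d)} (hD : D ⊆ Λ) (ξ : LocalConfig d q D) :
    lossTerm f D ξ ν Λ ≤ ε * Fintype.card (LocalConfig d q D) := by
  have hR := continuous_logRatio ν D ξ Λ
  obtain ⟨η₀⟩ : Nonempty (Config d q) := ν.nonempty
  have hε0 : 0 ≤ ε := (hf0 η₀).trans (hε η₀)
  have i1 : lossTerm f D ξ ν Λ ≤
      ∫ η, ε * Real.exp (logRatio ν D ξ Λ η) ∂(ν : Measure (Config d q)) := by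
    refine integral_mono ((hf.mul hR).integrable_config ν)
      ((continuous_const.mul hR.rexp).integrable_config ν) fun η => ?_
    have h1 : logRatio ν D ξ Λ η ≤ Real.exp (logRatio ν D ξ Λ η) := by
      linarith [Real.add_one_le_exp (logRatio ν D ξ Λ η)]
    exact (mul_le_mul_of_nonneg_left h1 (hf0 η)).trans
      (mul_le_mul_of_nonneg_right (hε η) (Real.exp_pos _).le)
  refine i1.trans ?_
  rw [integral_const_mul]
  refine mul_le_mul_of_nonneg_left ?_ hε0
  have i2 := integral_mul_cylProb_ratio ν hD (hν.cylProb_pos Λ) ξ (h := fun _ => 1)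
    (fun _ _ _ => rfl)
  simp only [one_mul] at i2
  simp_rw [hν.exp_logRatio]
  rw [i2]
  refine (Real.le_norm_self _).trans ((norm_integral_le_of_norm_le_const
    (C := Fintype.card (LocalConfig d q D)) (Eventually.of_forall fun η => ?_)).trans_eq ?_)
  · split_ifs <;> simp
  · simp

/-- The loss terms of a continuous rate converge: those of local rates do by monotonicity, and
the log ratios are bounded uniformly in the volume. -/
theorem FiniteEnergy.cauchySeq_lossTerm (hν : FiniteEnergy ν δ) {f : Config d q → ℝ}
    (hf : Continuous f) (hf0 : ∀ η, 0 ≤ f η) (D : Finset (Site d)) (ξ : LocalConfig d q D) :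
    CauchySeq (lossTerm f D ξ ν) := by
  -- Local rates give monotone bounded nets.
  have hloc : ∀ (Λ₀ : Finset (Site d)) (g : Config d q → ℝ), DependsOn g (Λ₀ : Set (Site d)) →
      (∀ η, 0 ≤ g η) → CauchySeq (lossTerm g D ξ ν) := by
    intro Λ₀ g hg hg0
    have hanti : Antitone fun Λ => lossTerm g D ξ ν (Λ ∪ (Λ₀ ∪ D)) := fun Λ Λ' h =>
      hν.lossTerm_anti ξ
        (hg.mono (by push_cast; exact fun x hx => Or.inr (Or.inl hx))) hg0
        (fun x hx => by simp [hx]) (Finset.union_subset_union_left h)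
    obtain ⟨C, hC⟩ := isCompact_univ.exists_bound_of_continuousOn
      (continuous_of_dependsOn hg).continuousOn
    have hbdd : BddBelow (Set.range fun Λ => lossTerm g D ξ ν (Λ ∪ (Λ₀ ∪ D))) := by
      refine ⟨-(C * (D.card * -Real.log δ)), ?_⟩
      rintro _ ⟨Λ, rfl⟩
      exact (abs_le.1 (hν.abs_lossTerm_le (fun η => hC η (Set.mem_univ η)) D _ ξ)).1
    have := tendsto_atTop_ciInf hanti hbdd
    refine (this.congr' ?_).cauchySeq
    filter_upwards [eventually_ge_atTop (Λ₀ ∪ D)] with Λ hΛ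
    rw [Finset.union_eq_left.2 hΛ]
  rw [Metric.cauchySeq_iff]
  intro ε hε
  set K : ℝ := D.card * -Real.log δ
  have hK : 0 ≤ K := mul_nonneg (Nat.cast_nonneg _)
    (neg_nonneg.2 (Real.log_nonpos hν.pos.le hν.le_one))
  obtain ⟨Λ₀, g, hg, hg0, hgf, hfg⟩ := exists_local_le hf hf0
    (show 0 < ε / (4 * (K + 1)) by positivity)
  have hclose : ∀ Λ, |lossTerm f D ξ ν Λ - lossTerm g D ξ ν Λ| ≤ ε / 4 := by
    intro Λ
    rw [← lossTerm_sub hf (continuous_of_dependsOn hg)]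
    refine (hν.abs_lossTerm_le (C := ε / (4 * (K + 1))) (fun η => ?_) D Λ ξ).trans ?_
    · rw [abs_of_nonneg (sub_nonneg.2 (hgf η))]
      exact hfg η
    · change ε / (4 * (K + 1)) * K ≤ ε / 4
      rw [div_mul_eq_mul_div, div_le_div_iff₀ (by positivity) (by positivity)]
      nlinarith
  obtain ⟨N, hN⟩ := Metric.cauchySeq_iff.1 (hloc Λ₀ g hg hg0) (ε / 4) (by positivity)
  refine ⟨N, fun Λ hΛ Λ' hΛ' => ?_⟩
  have h1 := hN Λ hΛ Λ' hΛ'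
  have h2 := hclose Λ
  have h3 := hclose Λ'
  rw [Real.dist_eq] at *
  rw [abs_lt] at *
  rw [abs_le] at *
  constructor <;> linarith

/-- The limit of the loss terms along all finite volumes (meaningful when it exists). -/
noncomputable def limitTerm (f : Config d q → ℝ) (D : Finset (Site d)) (ξ : LocalConfig d q D)
    (ν : ProbabilityMeasure (Config d q)) : ℝ :=
  limUnder atTop (lossTerm f D ξ ν)

theorem FiniteEnergy.tendsto_lossTerm (hν : FiniteEnergy ν δ) {f : Config d q → ℝ}
    (hf : Continuous f) (hf0 : ∀ η, 0 ≤ f η) (D : Finset (Site d)) (ξ : LocalConfig d q D) :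
    Tendsto (lossTerm f D ξ ν) atTop (𝓝 (limitTerm f D ξ ν)) :=
  (hν.cauchySeq_lossTerm hf hf0 D ξ).tendsto_limUnder

theorem FiniteEnergy.continuousAt_lossTerm (hν : FiniteEnergy ν δ) {D Λ : Finset (Site d)}
    (ξ : LocalConfig d q D) {g : Config d q → ℝ} (hg : DependsOn g (Λ : Set (Site d))) :
    ContinuousAt (fun ν => lossTerm g D ξ ν Λ) ν := by
  obtain ⟨η₀⟩ : Nonempty (Config d q) := ν.nonempty
  have : (fun ν => lossTerm g D ξ ν Λ) = fun ν => ∑ ω : LocalConfig d q Λ,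
      g (patch Λ ω η₀) * (Real.log (cylProb ν Λ (patch D ξ (patch Λ ω η₀))) -
        Real.log (cylProb ν Λ (patch Λ ω η₀))) * cylProb ν Λ (patch Λ ω η₀) := by
    ext ν
    rw [lossTerm, integral_eq_sum_of_dependsOn ν η₀ (Λ := Λ)]
    · refine Finset.sum_congr rfl fun ω _ => ?_
      simp only [logRatio, cylProb, restrict_patch]
    · intro η η' e
      simp only [hg e, dependsOn_logRatio ν D ξ Λ e]
  rw [this]
  refine tendsto_finsetSum _ fun ω _ => ?_
  have hc := fun η => (continuous_cylProb (q := q) Λ η).continuousAt (x := ν)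
  exact (tendsto_const_nhds.mul (((hc _).log (hν.cylProb_pos _ _).ne').sub
    ((hc _).log (hν.cylProb_pos _ _).ne'))).mul (hc _)

theorem upperSemicontinuousOn_limitTerm {f : Config d q → ℝ} (hf : Continuous f)
    (hf0 : ∀ η, 0 ≤ f η) (D : Finset (Site d)) (ξ : LocalConfig d q D) :
    UpperSemicontinuousOn (limitTerm f D ξ) {ν | ∃ δ, FiniteEnergy ν δ} := by
  rintro ν₀ ⟨δ₀, hν₀⟩ y hy
  set N : ℝ := (Fintype.card (LocalConfig d q D) : ℝ)
  have hN : 0 ≤ N := Nat.cast_nonneg _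
  set ε : ℝ := (y - limitTerm f D ξ ν₀) / (3 * (N + D.card * -Real.log δ₀ + 1)) with hεdef
  have hK : 0 ≤ D.card * -Real.log δ₀ := mul_nonneg (Nat.cast_nonneg _)
    (neg_nonneg.2 (Real.log_nonpos hν₀.pos.le hν₀.le_one))
  have hy' : 0 < y - limitTerm f D ξ ν₀ := sub_pos.2 hy
  have hε : 0 < ε := by positivity
  have hεN : ε * (N + D.card * -Real.log δ₀) ≤ (y - limitTerm f D ξ ν₀) / 3 := by
    rw [hεdef, div_mul_eq_mul_div, div_le_div_iff₀ (by positivity) (by positivity)]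
    nlinarith
  obtain ⟨Λ₀, g, hg, hg0, hgf, hfg⟩ := exists_local_le hf hf0 hε
  have hgc := continuous_of_dependsOn hg
  -- A volume in which the local loss term of `ν₀` is close to the limit.
  obtain ⟨Λ, hΛ, hΛ₀⟩ := (((hν₀.tendsto_lossTerm hf hf0 D ξ).eventually_lt_const
    (show limitTerm f D ξ ν₀ < limitTerm f D ξ ν₀ + (y - limitTerm f D ξ ν₀) / 3 by
      linarith)).and (eventually_ge_atTop (Λ₀ ∪ D))).exists
  have hgΛ : DependsOn g (Λ : Set (Site d)) :=
    hg.mono (Finset.coe_subset.2 (Finset.subset_union_left.trans hΛ₀))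
  have hDΛ : D ⊆ Λ := Finset.subset_union_right.trans hΛ₀
  have hsmall : lossTerm g D ξ ν₀ Λ + ε * N < y := by
    have h1 := hν₀.abs_lossTerm_le (f := fun η => f η - g η) (C := ε)
      (fun η => by rw [abs_of_nonneg (sub_nonneg.2 (hgf η))]; exact hfg η) D Λ ξ
    rw [lossTerm_sub hf hgc] at h1
    have := (abs_le.1 h1).1
    nlinarith
  -- For `ν` close to `ν₀` the local loss term in `Λ` is still small, and by monotonicity it
  -- dominates the local loss terms of `ν` in all larger volumes.
  filter_upwards [self_mem_nhdsWithin, mem_nhdsWithin_of_mem_nhds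
    ((hν₀.continuousAt_lossTerm ξ hgΛ).eventually_lt_const (lt_sub_iff_add_lt.2 hsmall))]
    with ν hν hclose
  obtain ⟨δ, hν⟩ := hν
  refine lt_of_le_of_lt (le_of_tendsto (hν.tendsto_lossTerm hf hf0 D ξ) ?_)
    (lt_sub_iff_add_lt.1 hclose)
  filter_upwards [eventually_ge_atTop Λ] with Λ' hΛ'
  have h1 := hν.lossTerm_le (hf.sub hgc) (fun η => sub_nonneg.2 (hgf η)) hfg
    (hDΛ.trans hΛ') ξ
  have h2 := lossTerm_sub (ν := ν) hf hgc D Λ' ξ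
  have h3 := hν.lossTerm_anti ξ hgΛ hg0 hDΛ hΛ'
  have h4 := h2.symm.trans_le h1
  linarith

/-! ### Translations -/

theorem mem_translate {i x : Site d} {Δ : Finset (Site d)} : x ∈ translate i Δ ↔ x - i ∈ Δ := by
  simp only [translate, Finset.mem_map, addRightEmbedding_apply]
  exact ⟨fun ⟨y, hy, h⟩ => by rwa [← h, add_sub_cancel_right],
    fun h => ⟨x - i, h, sub_add_cancel x i⟩⟩

theorem translate_translate (i j : Site d) (Δ : Finset (Site d)) :
    translate i (translate j Δ) = translate (j + i) Δ := by
  ext x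
  simp only [mem_translate]
  rw [sub_sub, add_comm i j]

@[simp]
theorem translate_zero (Δ : Finset (Site d)) : translate 0 Δ = Δ := by
  ext x
  simp [mem_translate]

theorem translate_inter (i : Site d) (Δ Λ : Finset (Site d)) :
    translate i (Δ ∩ Λ) = translate i Δ ∩ translate i Λ := by
  ext x
  simp [mem_translate]

theorem card_translate (i : Site d) (Δ : Finset (Site d)) : (translate i Δ).card = Δ.card :=
  Finset.card_map _

theorem measurable_shift (i : Site d) : Measurable (shift i : Config d q → Config d q) :=
  measurable_pi_lambda _ fun _ => measurable_pi_apply _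

theorem cylProb_translate {ν : ProbabilityMeasure (Config d q)}
    (hν : TranslationInvariantMeasure ν) (i : Site d) (Λ : Finset (Site d)) (η : Config d q) :
    cylProb ν (translate i Λ) (shift i η) = cylProb ν Λ η := by
  rw [cylProb, ← hν i, map_measureReal_apply (measurable_shift i) (measurableSet_cylinder _ _),
    cylProb]
  congr 1
  ext σ
  simp only [Set.mem_preimage, mem_cylinder_iff, restrict_eq_restrict_iff, mem_translate, shift]
  exact ⟨fun h x hx => by simpa using h (x + i) (by simpa using hx), fun h x hx => h _ hx⟩

/-! ### Non-nullness in finite volumes -/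

/-- Integrating the lower bound for the conditional probabilities over a cylinder off the
origin, and translating, bounds the cost of changing one spin in a cylinder. -/
theorem NonNull.exists_finiteEnergy {ν : ProbabilityMeasure (Config d q)} (h : NonNull ν)
    (hν : TranslationInvariantMeasure ν) : ∃ δ, FiniteEnergy ν δ := by
  obtain ⟨δ, hδ, hcond⟩ := h
  have horigin : ∀ (Λ : Finset (Site d)) (η η' : Config d q), (∀ y, y ≠ 0 → η y = η' y) →
      0 ∈ Λ → δ * cylProb ν Λ η ≤ cylProb ν Λ η' := by
    intro Λ η η' hη h0
    -- Integrate the conditional probability of `η' 0` at the origin over the cylinder `C` of `η'`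
    -- in `Λ` without the origin, which contains the cylinder of `η`.
    set C : Set (Config d q) := cylinder (Λ.erase 0) ((Λ.erase 0).restrict η') with hC
    set A : Set (Config d q) := {σ | σ 0 = η' 0} with hA
    have hm : offOrigin d q ≤ (inferInstance : MeasurableSpace (Config d q)) := by
      refine Measurable.comap_le ?_
      exact measurable_pi_lambda _ fun _ => measurable_pi_apply _
    have hAm : MeasurableSet A := measurable_pi_apply (0 : Site d) (measurableSet_singleton _)
    have hCm : MeasurableSet[offOrigin d q] C := by
      refine ⟨⋂ x : ↥(Λ.erase (0 : Site d)),
        (fun τ : {x : Site d // x ≠ 0} → Fin q => τ ⟨x.1, Finset.ne_of_mem_erase x.2⟩) ⁻¹'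
          {η' x.1}, ?_, ?_⟩
      · exact MeasurableSet.iInter fun x =>
          measurable_pi_apply _ (measurableSet_singleton (η' x.1))
      · ext σ
        simp [hC, cylinder]
    have hint : Integrable (A.indicator fun _ => (1 : ℝ)) (ν : Measure (Config d q)) :=
      (integrable_const 1).indicator hAm
    have h1 := setIntegral_condExp hm hint hCm
    have h2 : ∫ σ in C, A.indicator (fun _ => (1 : ℝ)) σ ∂(ν : Measure (Config d q)) =
        cylProb ν Λ η' := by
      rw [setIntegral_indicator hAm]
      simp only [integral_const, smul_eq_mul, mul_one, measureReal_restrict_apply_univ]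
      rw [cylProb]
      congr 1
      ext σ
      simp only [hC, hA, Set.mem_inter_iff, mem_cylinder_iff, restrict_eq_restrict_iff,
        Set.mem_ofPred_eq, Finset.mem_erase]
      constructor
      · rintro ⟨h3, h4⟩ x hx
        rcases eq_or_ne x 0 with rfl | hx0
        · exact h4
        · exact h3 x ⟨hx0, hx⟩
      · exact fun h3 => ⟨fun x hx => h3 x hx.2, h3 0 h0⟩
    have h3 : δ * (ν : Measure (Config d q)).real C ≤ cylProb ν Λ η' := by
      rw [← h2, ← h1]
      have := setIntegral_mono_ae (μ := (ν : Measure (Config d q))) (s := C)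
        (f := fun _ => δ) (integrable_const δ).integrableOn
        (integrable_condExp.integrableOn) (hcond (η' 0))
      simpa [mul_comm] using this
    refine (mul_le_mul_of_nonneg_left (measureReal_mono ?_) hδ.le).trans h3
    intro σ hσ
    rw [mem_cylinder_iff, restrict_eq_restrict_iff] at hσ
    rw [hC, mem_cylinder_iff, restrict_eq_restrict_iff]
    intro x hx
    rw [hσ x (Finset.mem_of_mem_erase hx), hη x (Finset.ne_of_mem_erase hx)]
  refine ⟨min δ 1, lt_min hδ one_pos, min_le_right _ _, fun x Λ η η' hη => ?_⟩
  have hnn : 0 ≤ cylProb ν Λ η := measureReal_nonneg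
  by_cases hx : x ∈ Λ
  · refine (mul_le_mul_of_nonneg_right (min_le_left _ _) hnn).trans ?_
    rw [← cylProb_translate hν (-x) Λ η, ← cylProb_translate hν (-x) Λ η']
    refine horigin _ _ _ (fun y hy => hη _ ?_) (by simpa [mem_translate] using hx)
    simpa [sub_neg_eq_add] using hy
  · have : cylProb ν Λ η = cylProb ν Λ η' := dependsOn_cylProb ν Λ fun y hy =>
      hη y fun e => hx (e ▸ Finset.mem_coe.1 hy)
    rw [← this]
    exact mul_le_of_le_one_left hnn (min_le_right _ _)

/-! ### The entropy loss as a sum over transitions -/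

namespace IPS

variable (L : IPS d q)

/-- The contribution of all the transitions in `Δ` to the entropy loss in `Λ`. -/
noncomputable def transitionLoss (ν : ProbabilityMeasure (Config d q))
    (Δ Λ : Finset (Site d)) : ℝ :=
  ∑ ξ : LocalConfig d q Δ, lossTerm (fun η => L.rate Δ η ξ) Δ ξ ν Λ

variable {L}

theorem rate_eq_zero {Δ : Finset (Site d)} (h : L.supRate Δ = 0) (η : Config d q)
    (ξ : LocalConfig d q Δ) : L.rate Δ η ξ = 0 := by
  have h1 : ENNReal.ofReal (L.totalRate Δ η) ≤ 0 :=
    (le_iSup (fun η => ENNReal.ofReal (L.totalRate Δ η)) η).trans_eq h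
  have h2 : L.totalRate Δ η ≤ 0 := ENNReal.ofReal_eq_zero.1 (nonpos_iff_eq_zero.1 h1)
  exact le_antisymm ((Finset.single_le_sum (fun ξ _ => L.rate_nonneg Δ η ξ)
    (Finset.mem_univ ξ)).trans h2) (L.rate_nonneg Δ η ξ)

theorem transitionLoss_eq_zero {ν : ProbabilityMeasure (Config d q)} {Δ Λ : Finset (Site d)}
    (h : ∀ η ξ, L.rate Δ η ξ = 0) : L.transitionLoss ν Δ Λ = 0 := by
  simp [transitionLoss, lossTerm, h]

/-- The finite-volume entropy loss is the sum of the losses of the transitions that are possible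
and that meet the volume; by `hS` all of these belong to `S`. -/
theorem sum_integral_generator_mul_log (ν : ProbabilityMeasure (Config d q))
    {Λ : Finset (Site d)} {S : Finset (Finset (Site d))}
    (hS : ∀ Δ ∉ S, (∀ η ξ, L.rate Δ η ξ = 0) ∨ Disjoint Δ Λ) :
    ∑ ω : LocalConfig d q Λ,
      (∫ η, L.generator ((cylinder Λ ω).indicator 1) η ∂(ν : Measure (Config d q))) *
        Real.log ((ν : Measure (Config d q)).real (cylinder Λ ω)) =
      ∑ Δ ∈ S, L.transitionLoss ν Δ Λ := by
  have hgen : ∀ (ω : LocalConfig d q Λ) (η : Config d q),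
      L.generator ((cylinder Λ ω).indicator 1) η =
        ∑ Δ ∈ S, ∑ ξ : LocalConfig d q Δ, L.rate Δ η ξ *
          ((cylinder Λ ω).indicator (1 : Config d q → ℝ) (patch Δ ξ η) -
            (cylinder Λ ω).indicator (1 : Config d q → ℝ) η) := by
    intro ω η
    refine tsum_eq_sum fun Δ hΔ => Finset.sum_eq_zero fun ξ _ => ?_
    rcases hS Δ hΔ with h | h
    · rw [h, zero_mul]
    · have : patch Δ ξ η ∈ cylinder Λ ω ↔ η ∈ cylinder Λ ω := by
        rw [mem_cylinder_iff, mem_cylinder_iff]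
        have : Λ.restrict (patch Δ ξ η) = Λ.restrict η := restrict_eq_restrict_iff.2
          fun x hx => patch_of_notMem _ _ fun hx' => Finset.disjoint_left.1 h hx' hx
        rw [this]
      have : (cylinder Λ ω).indicator (1 : Config d q → ℝ) (patch Δ ξ η) =
          (cylinder Λ ω).indicator (1 : Config d q → ℝ) η := by
        classical simp only [Set.indicator_apply, this, Pi.one_apply]
      rw [this, sub_self, mul_zero]
  have hcont : ∀ (ω : LocalConfig d q Λ) (Δ : Finset (Site d)) (ξ : LocalConfig d q Δ),
      Continuous fun η => L.rate Δ η ξ *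
          ((cylinder Λ ω).indicator (1 : Config d q → ℝ) (patch Δ ξ η) -
            (cylinder Λ ω).indicator (1 : Config d q → ℝ) η) := fun ω Δ ξ =>
    (L.rate_continuous Δ ξ).mul (((continuous_indicator_cylinder Λ ω).comp
      (continuous_patch Δ ξ)).sub (continuous_indicator_cylinder Λ ω))
  have hlog : ∀ η, ∑ ω : LocalConfig d q Λ, (cylinder Λ ω).indicator (1 : Config d q → ℝ) η *
      Real.log ((ν : Measure (Config d q)).real (cylinder Λ ω)) = Real.log (cylProb ν Λ η) := by
    intro η
    rw [Finset.sum_eq_single (Λ.restrict η)]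
    · rw [Set.indicator_of_mem (mem_cylinder_iff.2 rfl), Pi.one_apply, one_mul, cylProb]
    · intro ω _ hω
      rw [Set.indicator_of_notMem (fun hm => hω (mem_cylinder_iff.1 hm).symm), zero_mul]
    · simp
  calc _ = ∑ ω : LocalConfig d q Λ, ∑ Δ ∈ S, ∑ ξ : LocalConfig d q Δ,
        (∫ η, L.rate Δ η ξ *
          ((cylinder Λ ω).indicator (1 : Config d q → ℝ) (patch Δ ξ η) -
            (cylinder Λ ω).indicator (1 : Config d q → ℝ) η) ∂(ν : Measure (Config d q))) *
          Real.log ((ν : Measure (Config d q)).real (cylinder Λ ω)) := by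
        refine Finset.sum_congr rfl fun ω _ => ?_
        rw [integral_congr_ae (Eventually.of_forall (hgen ω)), integral_finsetSum _ fun Δ _ =>
          integrable_finsetSum _ fun ξ _ => (hcont ω Δ ξ).integrable_config ν, Finset.sum_mul]
        refine Finset.sum_congr rfl fun Δ _ => ?_
        rw [integral_finsetSum _ fun ξ _ => (hcont ω Δ ξ).integrable_config ν, Finset.sum_mul]
    _ = ∑ Δ ∈ S, ∑ ξ : LocalConfig d q Δ, ∑ ω : LocalConfig d q Λ,
        (∫ η, L.rate Δ η ξ *
          ((cylinder Λ ω).indicator (1 : Config d q → ℝ) (patch Δ ξ η) -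
            (cylinder Λ ω).indicator (1 : Config d q → ℝ) η) ∂(ν : Measure (Config d q))) *
          Real.log ((ν : Measure (Config d q)).real (cylinder Λ ω)) := by
        rw [Finset.sum_comm]
        exact Finset.sum_congr rfl fun Δ _ => Finset.sum_comm
    _ = _ := by
        refine Finset.sum_congr rfl fun Δ _ => Finset.sum_congr rfl fun ξ _ => ?_
        simp_rw [← integral_mul_const]
        rw [← integral_finsetSum _ fun ω _ => ((hcont ω Δ ξ).integrable_config ν).mul_const _,
          lossTerm]
        refine integral_congr_ae (Eventually.of_forall fun η => ?_)
        simp only [mul_assoc, sub_mul, ← Finset.mul_sum, Finset.sum_sub_distrib, hlog, logRatio]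

/-- Translating both the transitions and the volume does not change the loss. -/
theorem transitionLoss_translate (hL : L.TranslationInvariant)
    {ν : ProbabilityMeasure (Config d q)} (hν : TranslationInvariantMeasure ν) (i : Site d)
    (Δ Λ : Finset (Site d)) :
    L.transitionLoss ν (translate i Δ) (translate i Λ) = L.transitionLoss ν Δ Λ := by
  have hint : ∀ Δ Λ : Finset (Site d), L.transitionLoss ν Δ Λ =
      ∫ η, ∑ ξ : LocalConfig d q Δ, L.rate Δ η ξ * logRatio ν Δ ξ Λ η
        ∂(ν : Measure (Config d q)) := fun Δ Λ =>
    (integral_finsetSum _ fun ξ _ =>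
      ((L.rate_continuous Δ ξ).mul (continuous_logRatio ν Δ ξ Λ)).integrable_config ν).symm
  have hcont : Continuous fun η => ∑ ξ : LocalConfig d q (translate i Δ),
      L.rate (translate i Δ) η ξ * logRatio ν (translate i Δ) ξ (translate i Λ) η :=
    continuous_finsetSum _ fun ξ _ =>
      (L.rate_continuous _ ξ).mul (continuous_logRatio ν _ ξ _)
  rw [hint, hint]
  conv_lhs => rw [← hν i]
  rw [integral_map (measurable_shift i).aemeasurable hcont.aestronglyMeasurable]
  refine integral_congr_ae (Eventually.of_forall fun η => ?_)
  have hpatch : ∀ ξ : LocalConfig d q Δ,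
      patch (translate i Δ) ((translate i Δ).restrict (shift i (patch Δ ξ η))) (shift i η) =
        shift i (patch Δ ξ η) := by
    intro ξ
    ext1 x
    by_cases hx : x ∈ translate i Δ
    · rw [patch_of_mem _ _ hx]; rfl
    · rw [patch_of_notMem _ _ hx, shift, shift, patch_of_notMem]
      rwa [← mem_translate]
  symm
  refine Finset.sum_bij (fun ξ _ => (translate i Δ).restrict (shift i (patch Δ ξ η)))
    (fun _ _ => Finset.mem_univ _) ?_ ?_ ?_
  · intro ξ _ ξ' _ h
    have h2 := restrict_eq_restrict_iff.1 h
    rw [← restrict_patch Δ ξ η, ← restrict_patch Δ ξ' η, restrict_eq_restrict_iff]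
    intro x hx
    have := h2 (x + i) (by simpa [mem_translate] using hx)
    simpa [shift] using this
  · intro ξ _
    refine ⟨Δ.restrict (shift (-i) (patch (translate i Δ) ξ (shift i η))), Finset.mem_univ _, ?_⟩
    ext1 x
    have hx := mem_translate.1 x.2
    simp only [Finset.restrict, shift]
    rw [patch_of_mem _ _ hx]
    change patch (translate i Δ) ξ (shift i η) (x.1 - i - -i) = ξ x
    rw [sub_neg_eq_add, sub_add_cancel]
    exact patch_of_mem _ _ x.2
  · intro ξ _
    have h1 := hL i Δ η (patch Δ ξ η)
    rw [restrict_patch] at h1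
    rw [h1, logRatio, logRatio, hpatch, cylProb_translate hν, cylProb_translate hν]

/-- The finite volumes containing the origin and contained in `Γ`. -/
def types (Γ : Finset (Site d)) : Finset (Finset (Site d)) :=
  Γ.powerset.filter fun D => 0 ∈ D

variable (L) in
/-- The share of the site at the origin in the entropy loss in `Λ`: the loss of each transition
is divided evenly among the sites of `Λ` that it affects. The value is meaningful if `0 ∈ Λ`;
otherwise the inverse of zero may occur, and boundedness is all that is used. -/
noncomputable def siteLoss (Γ : Finset (Site d)) (ν : ProbabilityMeasure (Config d q))
    (Λ : Finset (Site d)) : ℝ :=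
  ∑ D ∈ types Γ, ((D ∩ Λ).card : ℝ)⁻¹ * L.transitionLoss ν D Λ

variable (L) in
/-- The infinite-volume limit of `IPS.siteLoss`. -/
noncomputable def limitLoss (Γ : Finset (Site d)) (ν : ProbabilityMeasure (Config d q)) : ℝ :=
  ∑ D ∈ types Γ, (D.card : ℝ)⁻¹ * ∑ ξ : LocalConfig d q D, limitTerm (fun η => L.rate D η ξ) D ξ ν

theorem rate_eq_zero_of_not_subset (hL : L.TranslationInvariant) {Γ : Finset (Site d)}
    (hΓ : ∀ Δ : Finset (Site d), 0 ∈ Δ → ¬ Δ ⊆ Γ → L.supRate Δ = 0) {Δ : Finset (Site d)}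
    {x : Site d} (hx : x ∈ Δ) (hΔ : ¬ translate (-x) Δ ⊆ Γ) (η : Config d q)
    (ξ : LocalConfig d q Δ) : L.rate Δ η ξ = 0 := by
  have h := hL (-x) Δ η (patch Δ ξ η)
  rw [restrict_patch] at h
  rw [← h]
  exact rate_eq_zero (hΓ _ (by simpa [mem_translate] using hx) hΔ) _ _

/-- The entropy loss in `Λ`, rearranged as a sum over the sites of `Λ`: by translation invariance
each site contributes the share of the origin in the volume `Λ` seen from that site. -/
theorem sum_generator_eq_sum_siteLoss (hL : L.TranslationInvariant) {Γ : Finset (Site d)}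
    (hΓ : ∀ Δ : Finset (Site d), 0 ∈ Δ → ¬ Δ ⊆ Γ → L.supRate Δ = 0)
    (hν : TranslationInvariantMeasure ν) (Λ : Finset (Site d)) :
    ∑ ω : LocalConfig d q Λ,
      (∫ η, L.generator ((cylinder Λ ω).indicator 1) η ∂(ν : Measure (Config d q))) *
        Real.log ((ν : Measure (Config d q)).real (cylinder Λ ω)) =
      ∑ x ∈ Λ, L.siteLoss Γ ν (translate (-x) Λ) := by
  set S : Finset (Finset (Site d)) := Λ.biUnion fun x => (types Γ).image (translate x)
  have hmem : ∀ {Δ x}, x ∈ Λ → x ∈ Δ → translate (-x) Δ ⊆ Γ → Δ ∈ S := by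
    intro Δ x hxΛ hx hΔ
    refine Finset.mem_biUnion.2 ⟨x, hxΛ, Finset.mem_image.2 ⟨translate (-x) Δ, ?_, ?_⟩⟩
    · simp only [types, Finset.mem_filter, Finset.mem_powerset]
      exact ⟨hΔ, by simpa [mem_translate] using hx⟩
    · rw [translate_translate, neg_add_cancel, translate_zero]
  rw [sum_integral_generator_mul_log ν (S := S)]
  swap
  · intro Δ hΔ
    by_contra! hcon
    obtain ⟨⟨η, ξ, hne⟩, hdisj⟩ := hcon
    obtain ⟨x, hxΔ, hxΛ⟩ := Finset.not_disjoint_iff.1 hdisj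
    refine hΔ (hmem hxΛ hxΔ ?_)
    by_contra hsub
    exact hne (rate_eq_zero_of_not_subset hL hΓ hxΔ hsub η ξ)
  calc ∑ Δ ∈ S, L.transitionLoss ν Δ Λ
      = ∑ Δ ∈ S, ∑ x ∈ Λ, if x ∈ Δ then ((Δ ∩ Λ).card : ℝ)⁻¹ * L.transitionLoss ν Δ Λ else 0 := by
        refine Finset.sum_congr rfl fun Δ hΔ => ?_
        rw [← Finset.sum_filter, Finset.sum_const, nsmul_eq_mul, ← mul_assoc]
        have hcard : Λ.filter (fun x => x ∈ Δ) = Δ ∩ Λ := by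
          ext x; simp [and_comm]
        obtain ⟨x, hxΛ, hx⟩ := Finset.mem_biUnion.1 hΔ
        obtain ⟨D, hD, rfl⟩ := Finset.mem_image.1 hx
        have hpos : 0 < (translate x D ∩ Λ).card := Finset.card_pos.2 ⟨x, Finset.mem_inter.2
          ⟨by simpa [mem_translate] using (Finset.mem_filter.1 hD).2, hxΛ⟩⟩
        rw [hcard, mul_inv_cancel₀ (by positivity), one_mul]
    _ = ∑ x ∈ Λ, ∑ Δ ∈ S with x ∈ Δ, ((Δ ∩ Λ).card : ℝ)⁻¹ * L.transitionLoss ν Δ Λ := by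
        rw [Finset.sum_comm]
        simp only [Finset.sum_filter]
    _ = _ := by
        refine Finset.sum_congr rfl fun x hx => ?_
        symm
        refine Finset.sum_of_injOn (translate x) ?_ ?_ ?_ ?_
        · intro D _ D' _ h
          have := congrArg (translate (-x)) h
          simpa [translate_translate] using this
        · intro D hD
          have h0 := (Finset.mem_filter.1 (Finset.mem_coe.1 hD)).2
          refine Finset.mem_coe.2 (Finset.mem_filter.2
            ⟨Finset.mem_biUnion.2 ⟨x, hx, Finset.mem_image_of_mem _ hD⟩, ?_⟩)
          simpa [mem_translate] using h0
        · -- Volumes around `x` that are not a translate of a subset of `Γ` have rate zero.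
          intro Δ hΔ hΔ'
          have hxΔ := (Finset.mem_filter.1 hΔ).2
          rw [transitionLoss_eq_zero, mul_zero]
          refine rate_eq_zero_of_not_subset hL hΓ hxΔ fun hsub => hΔ' ⟨translate (-x) Δ, ?_, ?_⟩
          · simp only [types, Finset.coe_filter, Finset.mem_powerset, Set.mem_ofPred_eq]
            exact ⟨hsub, by simpa [mem_translate] using hxΔ⟩
          · rw [translate_translate, neg_add_cancel, translate_zero]
        · intro D _
          have h1 : translate x (translate (-x) Λ) = Λ := by
            rw [translate_translate, neg_add_cancel, translate_zero]
          conv_rhs => rw [← h1]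
          rw [transitionLoss_translate hL hν, ← translate_inter, card_translate]

theorem tendsto_siteLoss (hν : FiniteEnergy ν δ) (L : IPS d q) (Γ : Finset (Site d)) :
    Tendsto (L.siteLoss Γ ν) atTop (𝓝 (L.limitLoss Γ ν)) := by
  refine tendsto_finsetSum _ fun D _ => ?_
  have h1 : Tendsto (L.transitionLoss ν D) atTop
      (𝓝 (∑ ξ : LocalConfig d q D, limitTerm (fun η => L.rate D η ξ) D ξ ν)) :=
    tendsto_finsetSum _ fun ξ _ =>
      hν.tendsto_lossTerm (L.rate_continuous D ξ) (fun η => L.rate_nonneg D η ξ) D ξ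
  refine (h1.const_mul (D.card : ℝ)⁻¹).congr' ?_
  filter_upwards [eventually_ge_atTop D] with Λ hΛ
  rw [Finset.inter_eq_left.2 hΛ]

theorem exists_abs_siteLoss_le (hν : FiniteEnergy ν δ) (L : IPS d q) (Γ : Finset (Site d)) :
    ∃ C, ∀ Λ, |L.siteLoss Γ ν Λ| ≤ C := by
  have hterm : ∀ D : Finset (Site d), ∃ C, ∀ Λ,
      |((D ∩ Λ).card : ℝ)⁻¹ * L.transitionLoss ν D Λ| ≤ C := by
    intro D
    have hb : ∀ ξ : LocalConfig d q D, ∃ C, ∀ η, |L.rate D η ξ| ≤ C := by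
      intro ξ
      obtain ⟨C, hC⟩ := isCompact_univ.exists_bound_of_continuousOn
        (L.rate_continuous D ξ).continuousOn
      exact ⟨C, fun η => hC η (Set.mem_univ η)⟩
    choose C hC using hb
    refine ⟨∑ ξ, C ξ * (D.card * -Real.log δ), fun Λ => ?_⟩
    have h1 : |L.transitionLoss ν D Λ| ≤ ∑ ξ, C ξ * (D.card * -Real.log δ) :=
      (Finset.abs_sum_le_sum_abs _ _).trans
        (Finset.sum_le_sum fun ξ _ => hν.abs_lossTerm_le (hC ξ) D Λ ξ)
    rw [abs_mul, abs_of_nonneg (by positivity)]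
    exact (mul_le_of_le_one_left (abs_nonneg _) (Nat.cast_inv_le_one _)).trans h1
  choose C hC using hterm
  exact ⟨∑ D ∈ types Γ, C D, fun Λ => (Finset.abs_sum_le_sum_abs _ _).trans
    (Finset.sum_le_sum fun D _ => hC D Λ)⟩

theorem upperSemicontinuousOn_limitLoss (L : IPS d q) (Γ : Finset (Site d)) :
    UpperSemicontinuousOn (L.limitLoss Γ) {ν | ∃ δ, FiniteEnergy ν δ} := by
  refine upperSemicontinuousOn_sum fun D _ => ?_
  have hsum : UpperSemicontinuousOn
      (fun ν => ∑ ξ : LocalConfig d q D, limitTerm (fun η => L.rate D η ξ) D ξ ν)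
      {ν | ∃ δ, FiniteEnergy ν δ} :=
    upperSemicontinuousOn_sum fun ξ _ =>
      upperSemicontinuousOn_limitTerm (L.rate_continuous D ξ) (fun η => L.rate_nonneg D η ξ) D ξ
  have hmono : Monotone fun t : ℝ => (D.card : ℝ)⁻¹ * t := fun s t h =>
    mul_le_mul_of_nonneg_left h (by positivity)
  exact (continuous_const.mul continuous_id).comp_upperSemicontinuousOn hsum hmono

end IPS

/-! ### Averages over large boxes -/

theorem mem_box {n : ℕ} {x : Site d} : x ∈ box d n ↔ ∀ j, -(n : ℤ) ≤ x j ∧ x j ≤ n := by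
  simp [box, Pi.le_def, forall_and]

theorem box_mono {m n : ℕ} (h : m ≤ n) : box d m ⊆ box d n := by
  intro x hx
  rw [mem_box] at *
  intro j
  have := hx j
  omega

theorem card_box (n : ℕ) : (box d n).card = (2 * n + 1) ^ d := by
  rw [box, Pi.card_Icc]
  simp only [Int.card_Icc, Finset.prod_const, Finset.card_univ, Fintype.card_fin]
  congr 1
  omega

theorem exists_subset_box (M : Finset (Site d)) : ∃ m, M ⊆ box d m := by
  refine ⟨∑ x ∈ M, ∑ j, (x j).natAbs, fun x hx => mem_box.2 fun j => ?_⟩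
  have h1 : (x j).natAbs ≤ ∑ j, (x j).natAbs :=
    Finset.single_le_sum (f := fun j => (x j).natAbs) (fun _ _ => Nat.zero_le _)
      (Finset.mem_univ j)
  have h2 : ∑ j, (x j).natAbs ≤ ∑ x ∈ M, ∑ j, (x j).natAbs :=
    Finset.single_le_sum (f := fun x : Site d => ∑ j, (x j).natAbs) (fun _ _ => Nat.zero_le _) hx
  omega

theorem tendsto_card_box_sub_div (m : ℕ) :
    Tendsto (fun n => ((box d (n - m)).card : ℝ) / (box d n).card) atTop (𝓝 1) := by
  have h1 : Tendsto (fun n : ℕ => (1 - 2 * m / (2 * n + 1) : ℝ)) atTop (𝓝 (1 - 0)) := by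
    refine tendsto_const_nhds.sub (tendsto_const_nhds.div_atTop ?_)
    exact tendsto_atTop_add_const_right _ _
      (tendsto_natCast_atTop_atTop.const_mul_atTop two_pos)
  have h2 := h1.pow d
  rw [sub_zero, one_pow] at h2
  refine h2.congr' ?_
  filter_upwards [eventually_ge_atTop m] with n hn
  rw [card_box, card_box]
  push_cast [Nat.cast_sub hn]
  rw [← div_pow]
  congr 1
  field_simp
  ring

/-- A bounded function of finite volumes that converges along all finite volumes converges on
average over the positions in a large box, since most sites are far from the boundary. -/
theorem tendsto_average_box {B : Finset (Site d) → ℝ} {b C : ℝ} (hC : ∀ Λ, |B Λ| ≤ C)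
    (hB : Tendsto B atTop (𝓝 b)) :
    Tendsto (fun n => ((box d n).card : ℝ)⁻¹ * ∑ x ∈ box d n, B (translate (-x) (box d n)))
      atTop (𝓝 b) := by
  rw [Metric.tendsto_atTop]
  intro ε hε
  obtain ⟨M, hM⟩ := Metric.tendsto_atTop.1 hB (ε / 2) (half_pos hε)
  obtain ⟨m, hm⟩ := exists_subset_box M
  have hC0 : 0 ≤ C := (abs_nonneg _).trans (hC ∅)
  have hlim : Tendsto (fun n => (C + |b|) *
      (1 - ((box d (n - m)).card : ℝ) / (box d n).card)) atTop (𝓝 ((C + |b|) * (1 - 1))) :=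
    ((tendsto_card_box_sub_div m).const_sub 1).const_mul _
  rw [sub_self, mul_zero] at hlim
  obtain ⟨N, hN⟩ := (hlim.eventually_lt_const (half_pos hε)).exists_forall_of_atTop
  refine ⟨max N m, fun n hn => ?_⟩
  have hnm : m ≤ n := (le_max_right _ _).trans hn
  have hN := hN n ((le_max_left _ _).trans hn)
  have hcard : 0 < ((box d n).card : ℝ) := by
    rw [card_box]; positivity
  have hsub : box d (n - m) ⊆ box d n := box_mono (Nat.sub_le n m)
  -- Seen from a site at distance at least `m` from the boundary, the box contains `M`.
  have hinner : ∀ x ∈ box d (n - m), |B (translate (-x) (box d n)) - b| ≤ ε / 2 := by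
    intro x hx
    refine (hM _ (hm.trans fun y hy => ?_)).le
    rw [mem_translate, mem_box]
    rw [mem_box] at hx hy
    intro j
    have h1 := hx j
    have h2 := hy j
    simp only [sub_neg_eq_add, Pi.add_apply]
    omega
  have hsum : |∑ x ∈ box d n, (B (translate (-x) (box d n)) - b)| ≤
      (box d n \ box d (n - m)).card * (C + |b|) + (box d (n - m)).card * (ε / 2) := by
    refine (Finset.abs_sum_le_sum_abs _ _).trans ?_
    rw [← Finset.sum_sdiff hsub]
    refine add_le_add ?_ ?_
    · rw [← nsmul_eq_mul]
      exact Finset.sum_le_card_nsmul _ _ _ fun x _ =>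
        (abs_sub _ _).trans (add_le_add_left (hC _) _)
    · rw [← nsmul_eq_mul]
      exact Finset.sum_le_card_nsmul _ _ _ hinner
  have hsdiff : ((box d n \ box d (n - m)).card : ℝ) =
      (box d n).card - (box d (n - m)).card := by
    rw [Finset.card_sdiff_of_subset hsub, Nat.cast_sub (Finset.card_le_card hsub)]
  have heq : ((box d n).card : ℝ)⁻¹ * ∑ x ∈ box d n, B (translate (-x) (box d n)) - b =
      ((box d n).card : ℝ)⁻¹ * ∑ x ∈ box d n, (B (translate (-x) (box d n)) - b) := by
    rw [Finset.sum_sub_distrib, Finset.sum_const, nsmul_eq_mul]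
    field_simp
  rw [Real.dist_eq, heq, abs_mul, abs_of_pos (inv_pos.2 hcard), inv_mul_lt_iff₀ hcard]
  refine hsum.trans_lt ?_
  rw [hsdiff]
  have hle : ((box d (n - m)).card : ℝ) ≤ (box d n).card :=
    Nat.cast_le.2 (Finset.card_le_card hsub)
  have h3 : (((box d n).card : ℝ) - (box d (n - m)).card) * (C + |b|) <
      (box d n).card * (ε / 2) := by
    have := mul_lt_mul_of_pos_left hN hcard
    calc _ = ((box d n).card : ℝ) *
          ((C + |b|) * (1 - ((box d (n - m)).card : ℝ) / (box d n).card)) := by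
          field_simp
      _ < _ := this
  nlinarith

theorem IPS.tendsto_entropyLossIn {L : IPS d q} (hL : L.TranslationInvariant)
    {Γ : Finset (Site d)} (hΓ : ∀ Δ : Finset (Site d), 0 ∈ Δ → ¬ Δ ⊆ Γ → L.supRate Δ = 0)
    {ν : ProbabilityMeasure (Config d q)} (hν : TranslationInvariantMeasure ν) {δ : ℝ}
    (hδ : FiniteEnergy ν δ) :
    Tendsto (fun n => L.entropyLossIn (box d n) ν) atTop (𝓝 (L.limitLoss Γ ν)) := by
  obtain ⟨C, hC⟩ := exists_abs_siteLoss_le hδ L Γ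
  refine (tendsto_average_box hC (tendsto_siteLoss hδ L Γ)).congr fun n => ?_
  rw [IPS.entropyLossIn, sum_generator_eq_sum_siteLoss hL hΓ hν]

end EntropyLoss

theorem mainTheorem1 (d q : ℕ) (L : EntropyLoss.IPS d q)
    (hwd : L.WellDefined) (hti : L.TranslationInvariant)
    (hfin : L.FinitelyManyTypes) (hunif : L.UniformlyContinuousRates)
    (hmin : L.HasMinimalRate) (htrap : L.NoTrapStates) :
    (∀ ν : ProbabilityMeasure (EntropyLoss.Config d q),
      EntropyLoss.TranslationInvariantMeasure ν → EntropyLoss.NonNull ν →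
        Tendsto (fun n : ℕ => L.entropyLossIn (EntropyLoss.box d n) ν) atTop
          (𝓝 (L.specificEntropyLoss ν))) ∧
    UpperSemicontinuousOn L.specificEntropyLoss
      {ν : ProbabilityMeasure (EntropyLoss.Config d q) |
        EntropyLoss.TranslationInvariantMeasure ν ∧ EntropyLoss.NonNull ν} := by
  obtain ⟨Γ, -, hΓ⟩ := hfin
  have hlim : ∀ ν : ProbabilityMeasure (EntropyLoss.Config d q),
      EntropyLoss.TranslationInvariantMeasure ν → EntropyLoss.NonNull ν →
        Tendsto (fun n : ℕ => L.entropyLossIn (EntropyLoss.box d n) ν) atTop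
          (𝓝 (L.limitLoss Γ ν)) := by
    intro ν hν hnull
    obtain ⟨δ, hδ⟩ := hnull.exists_finiteEnergy hν
    exact EntropyLoss.IPS.tendsto_entropyLossIn hti hΓ hν hδ
  have heq : ∀ ν : ProbabilityMeasure (EntropyLoss.Config d q),
      EntropyLoss.TranslationInvariantMeasure ν → EntropyLoss.NonNull ν →
        L.specificEntropyLoss ν = L.limitLoss Γ ν :=
    fun ν hν hnull => (hlim ν hν hnull).limUnder_eq
  refine ⟨fun ν hν hnull => ?_, ?_⟩
  · rw [heq ν hν hnull]
    exact hlim ν hν hnull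
  · have husc := (EntropyLoss.IPS.upperSemicontinuousOn_limitLoss L Γ).mono
      fun ν (hν : EntropyLoss.TranslationInvariantMeasure ν ∧ EntropyLoss.NonNull ν) =>
        hν.2.exists_finiteEnergy hν.1
    intro ν hν y hy
    rw [heq ν hν.1 hν.2] at hy
    filter_upwards [husc ν hν y hy, self_mem_nhdsWithin] with μ hμy hμ
    rw [heq μ hμ.1 hμ.2]
    exact hμy
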